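/- Let $\Lambda$ be the infinite wedge space over a field $k$ of characteristic $0$ (e.g. $\mathbb{C}$): it has the basis $v_S=\underline{s_1}\wedge\underline{s_2}\wedge\cdots$, where $S=\{s_1>s_2>\cdots\}\subset\mathbb{Z}+\frac12$ runs over the subsets for which $\{s\in S: s>0\}$ and $\{s\notin S: s<0\}$ are finite, and the inner product $(\cdot,\cdot)$ in which the $v_S$ are orthonormal. Let $v_\emptyset=\underline{-\frac12}\wedge\underline{-\frac32}\wedge\cdots$, let $\psi_x$ ($x\in\mathbb{Z}+\frac12$) be the exterior multiplication by $\underline{x}$, let $\psi_x^*$ be its adjoint, and put $\alpha_n=\sum_{x\in\mathbb{Z}+\frac12}\psi_{x-n}\psi_x^*$ for $n\in\mathbb{Z}\setminus\{0\}$. Let $t=(t_1,t_2,\dots)$ and $t'=(t'_1,t'_2,\dots)$ be formal variables and set $$\Gamma_+(t)=\exp\Big(\sum_{n\ge1}t_n\alpha_n\Big),\qquad \Gamma_-(t')=\exp\Big(\sum_{n\ge1}t'_n\alpha_{-n}\Big),\qquad G=\Gamma_+(t)\,\Gamma_-(t')^{-1},$$ which are formal power series in $t,t'$ with coefficients in $\operatorname{End}(\Lambda)$.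 Put $\Psi_x=G\psi_xG^{-1}$, $\Psi_x^*=G\psi_x^*G^{-1}$, and define the kernel $$K(i,j)=(\Psi_i\Psi_j^*\,v_\emptyset,v_\emptyset)\in k[[t,t']],\qquad i,j\in\mathbb{Z}+\tfrac12,$$ where the matrix element is taken coefficient by coefficient. Define $J_n(t,t')\in k[[t,t']]$, $n\in\mathbb{Z}$, by $$J(z)=\exp\Big(\sum_{n\ge1}t_nz^n-\sum_{n\ge1}t'_nz^{-n}\Big)=\sum_{n\in\mathbb{Z}}J_n(t,t')\,z^n.$$ Then for all $i,j\in\mathbb{Z}+\frac12$ $$K(i,j)=\sum_{x\in\mathbb{Z}_{\ge0}+\frac12}J_{i+x}(t,t')\,J_{-j-x}(-t,-t'),$$ where the sum converges in $k[[t,t']]$: only finitely many $x$ contribute to the coefficient of each monomial in $t,t'$. -/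

import Mathlib

noncomputable section

namespace SchurMeasure

/-! ### Formal power series in the times `t₁, t₂, …` and `t'₁, t'₂, …` -/

/-- The formal variables: `inl n` is `tₙ` and `inr n` is `t'ₙ`, for `n = 1, 2, …`. -/
abbrev Var : Type := ℕ+ ⊕ ℕ+

/-- Formal power series in all the variables `tₙ`, `t'ₙ`, with coefficients in a (possibly
noncommutative) ring `A`; the variables are central. -/
abbrev TSeries (A : Type*) : Type _ := MvPowerSeries Var A

/-- The formal linear combination `∑ᵥ cᵥ · v` of all the variables `v`, with coefficients `cᵥ`
in `A`. -/
def linearSeries {A : Type*} [Semiring A] (c : Var → A) : TSeries A :=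
  fun d => ∑ v ∈ d.support, if d = Finsupp.single v 1 then c v else 0

/-- The exponential `exp F = ∑ₘ Fᵐ / m!` of a formal power series `F` without constant term.
For such an `F` the terms with `m > deg d` do not contribute to the coefficient of the monomial
`d`, see `coeff_formalExp_eq_sum`. -/
def formalExp (k : Type*) [Field k] {A : Type*} [Ring A] [Algebra k A] (F : TSeries A) :
    TSeries A :=
  fun d => ∑ m ∈ Finset.range (d.degree + 1),
    ((m.factorial : k)⁻¹) • MvPowerSeries.coeff d (F ^ m)

theorem coeff_formalExp_eq_sum (k : Type*) [Field k] {A : Type*} [Ring A] [Algebra k A]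
    (F : TSeries A) (hF : MvPowerSeries.constantCoeff F = 0) (d : Var →₀ ℕ) (N : ℕ)
    (hN : d.degree + 1 ≤ N) :
    MvPowerSeries.coeff d (formalExp k F) =
      ∑ m ∈ Finset.range N, ((m.factorial : k)⁻¹) • MvPowerSeries.coeff d (F ^ m) := by
  change ∑ m ∈ Finset.range (d.degree + 1), _ = _
  refine Finset.sum_subset (fun m hm => ?_) (fun m _ hm => ?_)
  · simp only [Finset.mem_range] at hm ⊢
    omega
  · have h : d.degree < m := by
      simp only [Finset.mem_range] at hm
      omega
    rw [MvPowerSeries.coeff_of_lt_order, smul_zero]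
    exact lt_of_lt_of_le (by exact_mod_cast h)
      (MvPowerSeries.le_order_pow_of_constantCoeff_eq_zero m hF)

theorem constantCoeff_linearSeries {A : Type*} [Semiring A] (c : Var → A) :
    MvPowerSeries.constantCoeff (linearSeries c) = 0 := by
  change linearSeries c 0 = 0
  simp [linearSeries]

theorem constantCoeff_formalExp (k : Type*) [Field k] {A : Type*} [Ring A] [Algebra k A]
    (F : TSeries A) : MvPowerSeries.constantCoeff (formalExp k F) = 1 := by
  change ∑ m ∈ Finset.range ((0 : Var →₀ ℕ).degree + 1), _ = _
  simp

theorem isUnit_formalExp (k : Type*) [Field k] {A : Type*} [Ring A] [Algebra k A]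
    (F : TSeries A) : IsUnit (formalExp k F) := by
  rw [MvPowerSeries.isUnit_iff_constantCoeff, constantCoeff_formalExp]
  exact isUnit_one

/-- A family `f` of formal power series is summable coefficient by coefficient (only finitely many
members contribute to each monomial), and its sum is `a`. -/
def FormalHasSum {k ι : Type*} [Semiring k] (f : ι → TSeries k) (a : TSeries k) : Prop :=
  ∀ d : Var →₀ ℕ,
    (Function.support fun x => MvPowerSeries.coeff d (f x)).Finite ∧
      MvPowerSeries.coeff d a = ∑ᶠ x, MvPowerSeries.coeff d (f x)

/-! ### The multivariate Bessel functions -/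

/-- `J(z) = exp (∑ tₙ zⁿ - ∑ t'ₙ z⁻ⁿ)`, a formal power series in the times whose coefficients are
Laurent polynomials in `z`. -/
def J (k : Type*) [Field k] : TSeries (LaurentPolynomial k) :=
  formalExp k (linearSeries (Sum.elim
    (fun n => LaurentPolynomial.T (n : ℤ))
    (fun n => -LaurentPolynomial.T (-(n : ℤ)))))

/-- `Jₙ(t, t')`, the coefficient of `zⁿ` in `J(z)`. -/
def besselJ (k : Type*) [Field k] (n : ℤ) : TSeries k :=
  fun d => (MvPowerSeries.coeff d (J k)).coeff n

/-- The substitution `(t, t') ↦ (-t, -t')` in a formal power series. -/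
def negTimes {k : Type*} [Field k] (f : TSeries k) : TSeries k :=
  MvPowerSeries.rescale (fun _ => (-1 : k)) f

/-! ### The infinite wedge space -/

/-- The set `ℤ + 1/2` of half-integers. -/
def HalfInt : Type := {x : ℚ // ∃ n : ℤ, x = n + 1 / 2}

instance : LinearOrder HalfInt := inferInstanceAs (LinearOrder {x : ℚ // ∃ n : ℤ, x = n + 1 / 2})

/-- The half-integer `x - n`, for an integer `n`. -/
def HalfInt.shift (x : HalfInt) (n : ℤ) : HalfInt :=
  ⟨x.1 - n, by
    obtain ⟨m, hm⟩ := x.2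
    exact ⟨m - n, by rw [hm]; push_cast; ring⟩⟩

/-- The sets `S ⊆ ℤ + 1/2` for which `S₊ = S ∖ {-1/2, -3/2, …}` and
`S₋ = {-1/2, -3/2, …} ∖ S` are finite. -/
def Config : Type :=
  {S : Set HalfInt // {x | x ∈ S ∧ 0 < x.1}.Finite ∧ {x | x ∉ S ∧ x.1 < 0}.Finite}

/-- The configuration `S ∪ {x}`. -/
def Config.insert (S : Config) (x : HalfInt) : Config :=
  ⟨Set.insert x S.1, by
    refine ⟨(S.2.1.union (Set.finite_singleton x)).subset ?_, S.2.2.subset ?_⟩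
    · rintro y ⟨rfl | hy, h0⟩
      · exact Or.inr rfl
      · exact Or.inl ⟨hy, h0⟩
    · rintro y ⟨hy, h0⟩
      exact ⟨fun h => hy (Or.inr h), h0⟩⟩

/-- The configuration `S ∖ {x}`. -/
def Config.erase (S : Config) (x : HalfInt) : Config :=
  ⟨S.1 \ {x}, by
    refine ⟨S.2.1.subset ?_, (S.2.2.union (Set.finite_singleton x)).subset ?_⟩
    · rintro y ⟨hy, h0⟩
      exact ⟨hy.1, h0⟩
    · rintro y ⟨hy, h0⟩
      by_cases h : y = x
      · exact Or.inr h
      · exact Or.inl ⟨fun hS => hy ⟨hS, h⟩, h0⟩⟩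

/-- The configuration `{-1/2, -3/2, …}` of the vacuum. -/
def Config.vacuum : Config :=
  ⟨{x | x.1 < 0}, by
    constructor
    · convert Set.finite_empty (α := HalfInt)
      ext x
      simp only [Set.mem_ofPred_eq, Set.mem_empty_iff_false, iff_false, not_and, not_lt]
      exact fun h => h.le
    · convert Set.finite_empty (α := HalfInt)
      ext x
      simp⟩

/-- The infinite wedge space, with basis `v_S = s₁ ∧ s₂ ∧ s₃ ∧ ⋯` where
`S = {s₁ > s₂ > s₃ > ⋯}`. -/
abbrev Wedge (k : Type*) [Field k] : Type _ := Config →₀ k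

/-- The basis vector `v_S`. -/
def basisVec (k : Type*) [Field k] (S : Config) : Wedge k := Finsupp.single S 1

/-- The inner product for which the vectors `v_S` are orthonormal. -/
def innerProd {k : Type*} [Field k] (f g : Wedge k) : k := f.sum fun S a => a * g S

/-- The sign by which `x ∧ v_S` differs from the basis vector with `x` moved to its place in the
decreasing order: `-1` to the number of elements of `S` that are larger than `x`. -/
def wedgeSign (k : Type*) [Field k] (S : Config) (x : HalfInt) : k :=
  (-1) ^ {s | s ∈ S.1 ∧ x < s}.ncard

open Classical in
/-- The operator `ψₓ` of exterior multiplication by `x`. -/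
def psi (k : Type*) [Field k] (x : HalfInt) : Module.End k (Wedge k) :=
  Finsupp.linearCombination k fun S : Config =>
    if x ∈ S.1 then 0 else wedgeSign k S x • basisVec k (S.insert x)

open Classical in
/-- The operator `ψ*ₓ`, the adjoint of `ψₓ`, see `innerProd_psi`. -/
def psiStar (k : Type*) [Field k] (x : HalfInt) : Module.End k (Wedge k) :=
  Finsupp.linearCombination k fun S : Config =>
    if x ∈ S.1 then wedgeSign k S x • basisVec k (S.erase x) else 0

theorem wedgeSign_insert (k : Type*) [Field k] (S : Config) (x : HalfInt) :
    wedgeSign k (S.insert x) x = wedgeSign k S x := by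
  have h : {s | s ∈ (S.insert x).1 ∧ x < s} = {s | s ∈ S.1 ∧ x < s} := by
    ext s
    constructor
    · rintro ⟨rfl | h, hs⟩
      · exact absurd hs (lt_irrefl _)
      · exact ⟨h, hs⟩
    · rintro ⟨h, hs⟩
      exact ⟨Or.inr h, hs⟩
  rw [wedgeSign, wedgeSign, h]

theorem insert_eq_iff {S T : Config} {x : HalfInt} (hx : x ∉ S.1) :
    S.insert x = T ↔ x ∈ T.1 ∧ T.erase x = S := by
  constructor
  · rintro rfl
    refine ⟨Or.inl rfl, Subtype.ext (Set.ext fun s => ⟨?_, fun hs => ⟨Or.inr hs, ?_⟩⟩)⟩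
    · rintro ⟨h | h, hs⟩
      · exact absurd h hs
      · exact h
    · rintro rfl
      exact hx hs
  · rintro ⟨hT, rfl⟩
    refine Subtype.ext (Set.ext fun s => ⟨?_, fun hs => ?_⟩)
    · rintro (rfl | hs)
      · exact hT
      · exact hs.1
    · by_cases h : s = x
      · exact Or.inl h
      · exact Or.inr ⟨hs, h⟩

theorem notMem_erase (T : Config) (x : HalfInt) : x ∉ (T.erase x).1 := fun h => h.2 rfl

/-- `ψ*ₓ` is the adjoint of `ψₓ`. -/
theorem innerProd_psi (k : Type*) [Field k] (x : HalfInt) (f g : Wedge k) :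
    innerProd (psi k x f) g = innerProd f (psiStar k x g) := by
  classical
  have add_left (f f' g : Wedge k) : innerProd (f + f') g = innerProd f g + innerProd f' g :=
    Finsupp.sum_add_index' (by simp) (by intros; ring)
  have add_right (f g g' : Wedge k) : innerProd f (g + g') = innerProd f g + innerProd f g' := by
    simp [innerProd, mul_add, Finsupp.sum, Finset.sum_add_distrib]
  have zero_left (g : Wedge k) : innerProd 0 g = 0 := Finsupp.sum_zero_index
  have zero_right (f : Wedge k) : innerProd f 0 = 0 := by simp [innerProd, Finsupp.sum]
  induction f using Finsupp.induction_linear with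
  | zero => rw [map_zero, zero_left, zero_left]
  | add f f' hf hf' => rw [map_add, add_left, add_left, hf, hf']
  | single S a =>
    induction g using Finsupp.induction_linear with
    | zero => rw [map_zero, zero_right, zero_right]
    | add g g' hg hg' => rw [map_add, add_right, add_right, hg, hg']
    | single T b =>
      simp only [psi, psiStar, Finsupp.linearCombination_single, basisVec]
      by_cases hS : x ∈ S.1
      · by_cases hT : x ∈ T.1
        · have h : T.erase x ≠ S := by
            rintro rfl
            exact notMem_erase T x hS
          simp [hS, hT, innerProd, h]
        · simp [hS, hT, innerProd]
      · by_cases hT : x ∈ T.1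
        · by_cases h : T.erase x = S
          · subst h
            have h2 := (insert_eq_iff (T := T) hS).2 ⟨hT, rfl⟩
            have h3 := wedgeSign_insert k (T.erase x) x
            rw [h2] at h3
            simp only [if_neg hS, if_pos hT, h2, h3, innerProd, Finsupp.smul_single, smul_eq_mul,
              mul_one]
            rw [Finsupp.sum_single_index (by simp), Finsupp.sum_single_index (by simp)]
            simp
            ring
          · have h2 : S.insert x ≠ T := fun h' => h ((insert_eq_iff hS).1 h').2
            simp only [if_neg hS, if_pos hT, innerProd, Finsupp.smul_single, smul_eq_mul, mul_one]
            rw [Finsupp.sum_single_index (by simp), Finsupp.sum_single_index (by simp)]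
            simp [h, h2.symm]
        · have h2 : S.insert x ≠ T := fun h' => hT ((insert_eq_iff hS).1 h').1
          simp only [if_neg hS, if_neg hT, innerProd, Finsupp.smul_single, smul_eq_mul, mul_one]
          rw [Finsupp.sum_single_index (by simp)]
          simp [h2.symm]

/-! ### Bosons, vertex operators and the kernel -/

/-- The operator `αₙ = ∑ₓ ψ_{x-n} ψ*ₓ` (for `n ≠ 0`), the sum being over all half-integers `x`;
on each basis vector it is a finite sum, see `finite_support_alpha`. -/
def alpha (k : Type*) [Field k] (n : ℤ) : Module.End k (Wedge k) :=
  Finsupp.linearCombination k fun S : Config =>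
    ∑ᶠ x : HalfInt, psi k (x.shift n) (psiStar k x (basisVec k S))

theorem finite_between (a b : ℚ) : {x : HalfInt | a ≤ x.1 ∧ x.1 ≤ b}.Finite := by
  have h : Set.InjOn (fun x : HalfInt => ⌊x.1⌋) {x : HalfInt | a ≤ x.1 ∧ x.1 ≤ b} := by
    rintro ⟨x, m, rfl⟩ - ⟨y, l, rfl⟩ - hxy
    have hf (i : ℤ) : ⌊(i : ℚ) + 1 / 2⌋ = i := by
      rw [Int.floor_eq_iff]
      constructor <;> linarith
    simp only [hf] at hxy
    subst hxy
    rfl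
  refine Set.Finite.of_finite_image ((Set.finite_Icc ⌊a⌋ ⌊b⌋).subset ?_) h
  rintro _ ⟨x, ⟨h1, h2⟩, rfl⟩
  exact ⟨Int.floor_le_floor h1, Int.floor_le_floor h2⟩

theorem finite_support_alpha (k : Type*) [Field k] (n : ℤ) (hn : n ≠ 0) (S : Config) :
    (Function.support fun x : HalfInt =>
      psi k (x.shift n) (psiStar k x (basisVec k S))).Finite := by
  classical
  have hinj : Function.Injective fun x : HalfInt => x.shift n := by
    intro x y h
    have h' : x.1 - n = y.1 - n := congrArg Subtype.val h
    exact Subtype.ext (by linarith)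
  refine ((S.2.1.union (S.2.2.preimage hinj.injOn)).union
    (finite_between (-|(n : ℚ)|) |(n : ℚ)|)).subset ?_
  intro x hx
  have h1 : x ∈ S.1 := by
    by_contra h
    exact hx (by simp [psiStar, basisVec, h])
  have h2 : x.shift n ∉ S.1 := by
    intro h
    refine hx ?_
    have hne : x.shift n ≠ x := by
      intro he
      have he' : x.1 - n = x.1 := congrArg Subtype.val he
      exact hn (by exact_mod_cast (by linarith : (n : ℚ) = 0))
    have : x.shift n ∈ (S.erase x).1 := ⟨h, hne⟩
    simp [psiStar, psi, basisVec, h1, this]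
  by_cases h0 : 0 < x.1
  · exact Or.inl (Or.inl ⟨h1, h0⟩)
  by_cases h3 : (x.shift n).1 < 0
  · exact Or.inl (Or.inr ⟨h2, h3⟩)
  · refine Or.inr ⟨?_, ?_⟩
    · have : 0 ≤ x.1 - n := not_lt.1 h3
      have := neg_abs_le (n : ℚ)
      linarith
    · have := abs_nonneg (n : ℚ)
      linarith [not_lt.1 h0]

/-- Formal power series in the times with coefficients in the operators on the infinite wedge
space. -/
abbrev OpSeries (k : Type*) [Field k] : Type _ := TSeries (Module.End k (Wedge k))

/-- `Γ₊(t) = exp (∑ tₙ αₙ)`. -/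
def GammaPlus (k : Type*) [Field k] : OpSeries k :=
  formalExp k (linearSeries (Sum.elim (fun n => alpha k (n : ℤ)) (fun _ => 0)))

/-- `Γ₋(t') = exp (∑ t'ₙ α₋ₙ)`. -/
def GammaMinus (k : Type*) [Field k] : OpSeries k :=
  formalExp k (linearSeries (Sum.elim (fun _ => 0) (fun n => alpha k (-(n : ℤ)))))

theorem isUnit_GammaPlus (k : Type*) [Field k] : IsUnit (GammaPlus k) := isUnit_formalExp k _

theorem isUnit_GammaMinus (k : Type*) [Field k] : IsUnit (GammaMinus k) := isUnit_formalExp k _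

/-- `G = Γ₊(t) Γ₋(t')⁻¹`, an invertible element of the ring of operator-valued series. -/
def G (k : Type*) [Field k] : (OpSeries k)ˣ :=
  (isUnit_GammaPlus k).unit * (isUnit_GammaMinus k).unit⁻¹

/-- `Ψₓ = G ψₓ G⁻¹`. -/
def Psi (k : Type*) [Field k] (x : HalfInt) : OpSeries k :=
  (G k : OpSeries k) * MvPowerSeries.C (psi k x) * (((G k)⁻¹ : (OpSeries k)ˣ) : OpSeries k)

/-- `Ψ*ₓ = G ψ*ₓ G⁻¹`. -/
def PsiStar (k : Type*) [Field k] (x : HalfInt) : OpSeries k :=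
  (G k : OpSeries k) * MvPowerSeries.C (psiStar k x) * (((G k)⁻¹ : (OpSeries k)ˣ) : OpSeries k)

/-- The vacuum vector `v_∅`. -/
def vac (k : Type*) [Field k] : Wedge k := basisVec k Config.vacuum

/-- The vacuum matrix element `(A v_∅, v_∅)` of an operator-valued series `A`, taken coefficient
by coefficient. -/
def vacExp {k : Type*} [Field k] (A : OpSeries k) : TSeries k :=
  fun d => innerProd (MvPowerSeries.coeff d A (vac k)) (vac k)

/-- The kernel `K(x, y) = (Ψₓ Ψ*_y v_∅, v_∅)`. -/
def K (k : Type*) [Field k] (x y : HalfInt) : TSeries k := vacExp (Psi k x * PsiStar k y)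

end SchurMeasure

end

/-! Conjugation by `G` acts linearly on fermions, and the proof computes it as multiplication by a
commutative series. The anticommutation relations give `[αₙ, ψ_y] = ψ_{y-n}` and `[αₙ, ψ*_y] =
-ψ*_{y+n}` for `n ≠ 0`. Encode fermions by Laurent polynomials, `zⁿ ↦ ψ_{i-n}` (`psiLift`) and `zⁿ ↦
ψ*_{j+n}` (`psiStarLift`): the commutator with `αₙ` becomes multiplication by `zⁿ`, respectively
`-zⁿ`. Exponentiating, `Ψᵢ` is the image of `J(z)` and `Ψ*ⱼ` the image of `J(z)` at `(-t, -t')`,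
that is, `Ψᵢ = ∑ Jₙ(t, t') ψ_{i-n}` and `Ψ*ⱼ = ∑ Jₘ(-t, -t') ψ*_{j+m}`.

Since `(ψ_a ψ*_b v_∅, v_∅)` is `1` if `a = b < 0` and `0` otherwise, only the terms with `i - n = j
+ m = -x`, `x > 0`, survive. They have `n = i + x` and `m = -j - x`. Convergence holds because each
monomial in the times has a Laurent polynomial as its coefficient in `J`.

The exponentiation (`linearExp_mul_coeffMap_C`) rests on a differential equation. With `D = ∑ v
∂/∂v` and `F` linear in the variables, `X = exp F` solves `D X = F X` even over a noncommutative
ring, and a solution is determined by its constant term (`eq_of_euler_eq_mul`). Identities between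
exponentials thus reduce to one application of `D`. Neither commutation relations among the `αₙ` nor
the action of `Γ±` on the vacuum are needed. -/

noncomputable section

namespace SchurMeasure

/-! ### The Euler operator and linear differential equations for formal exponentials -/

section Euler

variable {A : Type*} [Ring A]

/-- The Euler operator `∑ᵥ v ∂/∂v`, which multiplies the monomial `d` by its degree. -/
def euler (f : TSeries A) : TSeries A := fun d => d.degree • MvPowerSeries.coeff d f

theorem coeff_euler (d : Var →₀ ℕ) (f : TSeries A) :
    MvPowerSeries.coeff d (euler f) = d.degree • MvPowerSeries.coeff d f := rfl

theorem euler_mul (f g : TSeries A) : euler (f * g) = euler f * g + f * euler g := by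
  classical
  ext d
  simp only [coeff_euler, map_add, MvPowerSeries.coeff_mul, Finset.smul_sum]
  rw [← Finset.sum_add_distrib]
  refine Finset.sum_congr rfl fun p hp => ?_
  rw [← Finset.HasAntidiagonal.mem_antidiagonal.1 hp, map_add, add_smul, smul_mul_assoc,
    mul_smul_comm]

/-- `F` is homogeneous of degree one, so its powers are homogeneous. The Leibniz rule yields this
without commutativity of `A`. -/
theorem euler_pow {F : TSeries A} (hF : euler F = F) (m : ℕ) : euler (F ^ m) = m • F ^ m := by
  induction m with
  | zero =>
    ext d
    classical
    rw [coeff_euler, pow_zero, MvPowerSeries.coeff_one]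
    split_ifs with h <;> simp [h]
  | succ m ih =>
    rw [pow_succ, euler_mul, ih, hF, succ_nsmul, smul_mul_assoc]

theorem linearSeries_neg (c : Var → A) : linearSeries (-c) = -linearSeries c := by
  ext d
  change ∑ v ∈ d.support, (if d = Finsupp.single v 1 then (-c) v else 0) =
    -∑ v ∈ d.support, if d = Finsupp.single v 1 then c v else 0
  rw [← Finset.sum_neg_distrib]
  refine Finset.sum_congr rfl fun v _ => ?_
  split_ifs <;> simp

theorem linearSeries_add (c c' : Var → A) :
    linearSeries (c + c') = linearSeries c + linearSeries c' := by
  ext d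
  change ∑ v ∈ d.support, (if d = Finsupp.single v 1 then (c + c') v else 0) =
    ∑ v ∈ d.support, (if d = Finsupp.single v 1 then c v else 0) +
      ∑ v ∈ d.support, if d = Finsupp.single v 1 then c' v else 0
  rw [← Finset.sum_add_distrib]
  refine Finset.sum_congr rfl fun v _ => ?_
  split_ifs <;> simp

theorem euler_linearSeries (c : Var → A) : euler (linearSeries c) = linearSeries c := by
  ext d
  change d.degree • ∑ v ∈ d.support, (if d = Finsupp.single v 1 then c v else 0) =
    ∑ v ∈ d.support, if d = Finsupp.single v 1 then c v else 0
  rw [Finset.smul_sum]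
  refine Finset.sum_congr rfl fun v _ => ?_
  split_ifs with h
  · simp [h]
  · simp

variable (k : Type*) [Field k] [CharZero k] [Algebra k A]

theorem euler_formalExp {F : TSeries A} (h0 : MvPowerSeries.constantCoeff F = 0)
    (hF : euler F = F) : euler (formalExp k F) = F * formalExp k F := by
  classical
  ext d
  have hR : MvPowerSeries.coeff d (F * formalExp k F) =
      ∑ m ∈ Finset.range (d.degree + 1),
        ((m.factorial : k)⁻¹) • MvPowerSeries.coeff d (F ^ (m + 1)) := by
    simp only [pow_succ', MvPowerSeries.coeff_mul, Finset.smul_sum]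
    rw [Finset.sum_comm]
    refine Finset.sum_congr rfl fun p hp => ?_
    rw [coeff_formalExp_eq_sum k F h0 p.2 (d.degree + 1), Finset.mul_sum]
    · simp only [mul_smul_comm]
    · rw [← Finset.HasAntidiagonal.mem_antidiagonal.1 hp, map_add]
      omega
  -- One extra term on the left: `D` kills `m = 0`, and the shift `m ↦ m + 1` then matches the range
  -- on the right.
  rw [hR, coeff_euler, coeff_formalExp_eq_sum k F h0 d (d.degree + 1 + 1) (by omega),
    Finset.smul_sum, Finset.sum_range_succ']
  have hm (m : ℕ) : d.degree • MvPowerSeries.coeff d (F ^ m) =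
      (m : k) • MvPowerSeries.coeff d (F ^ m) := by
    rw [← coeff_euler, euler_pow hF, Nat.cast_smul_eq_nsmul, map_nsmul]
  have hterm (m : ℕ) : d.degree • (((m.factorial : k)⁻¹) • MvPowerSeries.coeff d (F ^ m)) =
      ((m.factorial : k)⁻¹ * m) • MvPowerSeries.coeff d (F ^ m) := by
    rw [smul_comm, hm, smul_smul]
  simp only [hterm]
  rw [Nat.cast_zero, mul_zero, zero_smul, add_zero]
  refine Finset.sum_congr rfl fun m _ => ?_
  congr 1
  rw [Nat.factorial_succ]
  have h1 : (m.factorial : k) ≠ 0 := by exact_mod_cast m.factorial_ne_zero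
  have h2 : ((m + 1 : ℕ) : k) ≠ 0 := by exact_mod_cast m.succ_ne_zero
  push_cast at h2 ⊢
  field_simp

/-- A solution of `∑ᵥ v ∂X/∂v = F X` is determined by its constant term. -/
theorem eq_of_euler_eq_mul (k : Type*) [Field k] [CharZero k] {A : Type*} [Ring A] [Algebra k A]
    {F X Y : TSeries A} (h0 : MvPowerSeries.constantCoeff F = 0)
    (hX : euler X = F * X) (hY : euler Y = F * Y)
    (hXY : MvPowerSeries.constantCoeff X = MvPowerSeries.constantCoeff Y) : X = Y := by
  classical
  have key (n : ℕ) : ∀ d : Var →₀ ℕ, d.degree = n →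
      MvPowerSeries.coeff d X = MvPowerSeries.coeff d Y := by
    induction n using Nat.strong_induction_on with
    | _ n ih =>
      intro d hd
      by_cases hn : d.degree = 0
      · rw [Finsupp.degree_eq_zero_iff] at hn
        subst hn
        simpa using hXY
      · have h : d.degree • MvPowerSeries.coeff d X = d.degree • MvPowerSeries.coeff d Y := by
          rw [← coeff_euler, ← coeff_euler, hX, hY, MvPowerSeries.coeff_mul,
            MvPowerSeries.coeff_mul]
          refine Finset.sum_congr rfl fun p hp => ?_
          -- `F` has no constant term, so only coefficients of `X` and `Y` of lower degree enter.
          by_cases hp0 : p.1 = 0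
          · rw [hp0, MvPowerSeries.coeff_zero_eq_constantCoeff_apply, h0, zero_mul, zero_mul]
          · rw [ih p.2.degree _ p.2 rfl]
            rw [← hd, ← Finset.HasAntidiagonal.mem_antidiagonal.1 hp, map_add]
            have := mt (Finsupp.degree_eq_zero_iff p.1).1 hp0
            omega
        rw [← Nat.cast_smul_eq_nsmul k, ← Nat.cast_smul_eq_nsmul k] at h
        have hk : (d.degree : k) ≠ 0 := by exact_mod_cast hn
        rw [← inv_smul_smul₀ hk (MvPowerSeries.coeff d X), h, inv_smul_smul₀ hk]
  ext d
  exact key _ d rfl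

/-- The formal exponential of `∑ᵥ cᵥ · v`. -/
def linearExp (c : Var → A) : TSeries A := formalExp k (linearSeries c)

theorem euler_linearExp (c : Var → A) :
    euler (linearExp k c) = linearSeries c * linearExp k c :=
  euler_formalExp k (constantCoeff_linearSeries c) (euler_linearSeries c)

theorem constantCoeff_linearExp (k : Type*) [Field k] {A : Type*} [Ring A] [Algebra k A]
    (c : Var → A) :
    MvPowerSeries.constantCoeff (linearExp k c) = 1 := constantCoeff_formalExp k _

end Euler

/-! ### Formal exponentials over a commutative ring. -/

section Comm

variable (k : Type*) [Field k] [CharZero k] {P : Type*} [CommRing P] [Algebra k P]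

theorem linearExp_add (c c' : Var → P) :
    linearExp k (c + c') = linearExp k c * linearExp k c' := by
  refine eq_of_euler_eq_mul k (constantCoeff_linearSeries (c + c')) (euler_linearExp k _) ?_ ?_
  · rw [euler_mul, euler_linearExp, euler_linearExp, linearSeries_add]
    ring
  · simp [constantCoeff_linearExp]

theorem linearExp_zero : linearExp k (0 : Var → P) = 1 := by
  have h := linearExp_add k (0 : Var → P) 0
  rw [add_zero] at h
  exact (isUnit_formalExp k (linearSeries (0 : Var → P))).mul_left_cancel
    (by rw [mul_one]; exact h.symm)

theorem linearExp_neg_mul (c : Var → P) : linearExp k (-c) * linearExp k c = 1 := by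
  rw [← linearExp_add, neg_add_cancel, linearExp_zero]

theorem coeff_rescale_neg_one {R : Type*} [CommRing R] (d : Var →₀ ℕ) (f : TSeries R) :
    MvPowerSeries.coeff d (MvPowerSeries.rescale (fun _ => (-1 : R)) f) =
      (-1) ^ d.degree * MvPowerSeries.coeff d f := by
  rw [MvPowerSeries.coeff_rescale, Finsupp.prod, Finset.prod_pow_eq_pow_sum]
  rfl

/-- Rescaling commutes with `D` and negates a linear series, so both sides solve the same equation.
This identifies `J` at `(-t, -t')` as an exponential. -/
theorem rescale_neg_one_linearExp (c : Var → P) :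
    MvPowerSeries.rescale (fun _ => (-1 : P)) (linearExp k c) = linearExp k (-c) := by
  have heuler (f : TSeries P) : euler (MvPowerSeries.rescale (fun _ => (-1 : P)) f) =
      MvPowerSeries.rescale (fun _ => (-1 : P)) (euler f) := by
    ext d
    rw [coeff_euler, coeff_rescale_neg_one, coeff_rescale_neg_one, coeff_euler, mul_smul_comm]
  have hlin : MvPowerSeries.rescale (fun _ => (-1 : P)) (linearSeries c) =
      linearSeries (-c) := by
    rw [linearSeries_neg]
    ext d
    rw [coeff_rescale_neg_one, map_neg]
    change (-1) ^ d.degree * ∑ v ∈ d.support, (if d = Finsupp.single v 1 then c v else 0) =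
      -∑ v ∈ d.support, if d = Finsupp.single v 1 then c v else 0
    rw [Finset.mul_sum, ← Finset.sum_neg_distrib]
    refine Finset.sum_congr rfl fun v _ => ?_
    split_ifs with h <;> simp [h]
  refine eq_of_euler_eq_mul k (constantCoeff_linearSeries (-c)) ?_ (euler_linearExp k _) ?_
  · rw [heuler, euler_linearExp, map_mul, hlin]
  · rw [← MvPowerSeries.coeff_zero_eq_constantCoeff_apply, coeff_rescale_neg_one]
    simp [constantCoeff_linearExp]

end Comm

/-! ### Conjugation by formal exponentials -/

section Conjugation

variable {k : Type*} [Field k] {P A : Type*} [CommRing P] [Algebra k P] [Ring A] [Algebra k A]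

/-- The coefficientwise application of a linear map to a formal power series. -/
def coeffMap (φ : P →ₗ[k] A) (f : TSeries P) : TSeries A := fun d => φ (MvPowerSeries.coeff d f)

theorem coeff_coeffMap (φ : P →ₗ[k] A) (d : Var →₀ ℕ) (f : TSeries P) :
    MvPowerSeries.coeff d (coeffMap φ f) = φ (MvPowerSeries.coeff d f) := rfl

theorem coeffMap_C (φ : P →ₗ[k] A) (p : P) :
    coeffMap φ (MvPowerSeries.C p) = MvPowerSeries.C (φ p) := by
  classical
  ext d
  rw [coeff_coeffMap, MvPowerSeries.coeff_C, MvPowerSeries.coeff_C]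
  split_ifs <;> simp

theorem euler_coeffMap (φ : P →ₗ[k] A) (f : TSeries P) :
    euler (coeffMap φ f) = coeffMap φ (euler f) := by
  ext d
  rw [coeff_euler, coeff_coeffMap, coeff_coeffMap, coeff_euler, map_nsmul]

theorem linearSeries_mul_coeffMap (φ : P →ₗ[k] A) (c : Var → A) (l : Var → P)
    (h : ∀ v p, c v * φ p = φ p * c v + φ (l v * p)) (f : TSeries P) :
    linearSeries c * coeffMap φ f =
      coeffMap φ f * linearSeries c + coeffMap φ (linearSeries l * f) := by
  classical
  ext d
  rw [map_add, coeff_coeffMap, MvPowerSeries.coeff_mul, MvPowerSeries.coeff_mul,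
    MvPowerSeries.coeff_mul, map_sum, Finsupp.sum_antidiagonal_swap d fun a b =>
      MvPowerSeries.coeff a (coeffMap φ f) * MvPowerSeries.coeff b (linearSeries c),
    ← Finset.sum_add_distrib]
  refine Finset.sum_congr rfl fun p _ => ?_
  simp only [coeff_coeffMap]
  generalize MvPowerSeries.coeff p.2 f = q
  change (∑ v ∈ p.1.support, (if p.1 = Finsupp.single v 1 then c v else 0)) * φ q =
    φ q * (∑ v ∈ p.1.support, if p.1 = Finsupp.single v 1 then c v else 0) +
      φ ((∑ v ∈ p.1.support, if p.1 = Finsupp.single v 1 then l v else 0) * q)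
  rw [Finset.sum_mul, Finset.sum_mul, Finset.mul_sum, map_sum, ← Finset.sum_add_distrib]
  refine Finset.sum_congr rfl fun v _ => ?_
  split_ifs
  · exact h v q
  · simp

/-- Both sides solve `D X = linearSeries c * X` with constant term `φ p`; on the right, commuting
`linearSeries c` past `φ` produces exactly the derivative of `linearExp k l`. -/
theorem linearExp_mul_coeffMap_C [CharZero k] (φ : P →ₗ[k] A) (c : Var → A) (l : Var → P)
    (h : ∀ v p, c v * φ p = φ p * c v + φ (l v * p)) (p : P) :
    linearExp k c * coeffMap φ (MvPowerSeries.C p) =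
      coeffMap φ (linearExp k l * MvPowerSeries.C p) * linearExp k c := by
  have hC : euler (MvPowerSeries.C p : TSeries P) = 0 := by
    classical
    ext d
    rw [coeff_euler, MvPowerSeries.coeff_C]
    split_ifs with h <;> simp [h]
  have hC' : coeffMap φ (0 : TSeries P) = 0 := by
    ext d
    simp [coeff_coeffMap]
  refine eq_of_euler_eq_mul k (constantCoeff_linearSeries c) ?_ ?_ ?_
  · rw [euler_mul, euler_linearExp, euler_coeffMap, hC, hC', mul_zero, add_zero, mul_assoc]
  · rw [euler_mul, euler_linearExp, euler_coeffMap, euler_mul, hC, mul_zero, add_zero,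
      euler_linearExp, ← mul_assoc, ← mul_assoc, linearSeries_mul_coeffMap φ c l h, add_mul,
      ← mul_assoc, add_comm]
  · simp only [map_mul, constantCoeff_linearExp, one_mul, mul_one]
    simp only [← MvPowerSeries.coeff_zero_eq_constantCoeff_apply, coeff_coeffMap]
    simp [constantCoeff_linearExp]

/-- Non-constant `f` is needed because `Γ₊` acts on what `Γ₋⁻¹` has already turned into a series. -/
theorem linearExp_mul_coeffMap [CharZero k] (φ : P →ₗ[k] A) (c : Var → A) (l : Var → P)
    (h : ∀ v p, c v * φ p = φ p * c v + φ (l v * p)) (f : TSeries P) :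
    linearExp k c * coeffMap φ f = coeffMap φ (linearExp k l * f) * linearExp k c := by
  classical
  have hC (d : Var →₀ ℕ) (p : P) : MvPowerSeries.coeff d (linearExp k c) * φ p =
      ∑ q ∈ Finset.HasAntidiagonal.antidiagonal d, φ (MvPowerSeries.coeff q.1 (linearExp k l) * p) *
        MvPowerSeries.coeff q.2 (linearExp k c) := by
    have := congrArg (MvPowerSeries.coeff d) (linearExp_mul_coeffMap_C φ c l h p)
    rw [coeffMap_C, MvPowerSeries.coeff_mul_C, MvPowerSeries.coeff_mul] at this
    simpa only [MvPowerSeries.coeff_mul_C, coeff_coeffMap] using this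
  ext d
  simp only [MvPowerSeries.coeff_mul, coeff_coeffMap, hC, map_sum, Finset.sum_mul,
    Finset.sum_sigma']
  -- Both sides sum over triples of exponents adding up to `d`; the bijection swaps the last two,
  -- regrouping accordingly, and is its own inverse.
  refine Finset.sum_nbij' (fun x => ⟨(x.2.1 + x.1.2, x.2.2), (x.2.1, x.1.2)⟩)
    (fun x => ⟨(x.2.1 + x.1.2, x.2.2), (x.2.1, x.1.2)⟩) ?_ ?_ ?_ ?_ ?_
  · rintro ⟨⟨a, b⟩, ⟨u, v⟩⟩ h
    simp only [Finset.mem_sigma, Finset.HasAntidiagonal.mem_antidiagonal] at h ⊢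
    rw [← h.1, ← h.2]
    exact ⟨by abel, trivial⟩
  · rintro ⟨⟨a, b⟩, ⟨u, v⟩⟩ h
    simp only [Finset.mem_sigma, Finset.HasAntidiagonal.mem_antidiagonal] at h ⊢
    rw [← h.1, ← h.2]
    exact ⟨by abel, trivial⟩
  · rintro ⟨⟨a, b⟩, ⟨u, v⟩⟩ h
    simp only [Finset.mem_sigma, Finset.HasAntidiagonal.mem_antidiagonal] at h
    simp [← h.2]
  · rintro ⟨⟨a, b⟩, ⟨u, v⟩⟩ h
    simp only [Finset.mem_sigma, Finset.HasAntidiagonal.mem_antidiagonal] at h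
    simp [← h.2]
  · rintro ⟨⟨a, b⟩, ⟨u, v⟩⟩ h
    rfl

end Conjugation

/-! ### The canonical anticommutation relations -/

section Fermions

theorem Config.mem_insert {S : Config} {x y : HalfInt} :
    y ∈ (S.insert x).1 ↔ y = x ∨ y ∈ S.1 := Iff.rfl

theorem Config.mem_erase {S : Config} {x y : HalfInt} :
    y ∈ (S.erase x).1 ↔ y ∈ S.1 ∧ y ≠ x := Iff.rfl

theorem Config.ext_mem {S T : Config} (h : ∀ x, x ∈ S.1 ↔ x ∈ T.1) : S = T :=
  Subtype.ext (Set.ext h)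

/-- `Set.ncard` is `0` on infinite sets, so the sign flips on inserting a larger element only thanks
to this finiteness. -/
theorem Config.finite_gt (S : Config) (x : HalfInt) : {s | s ∈ S.1 ∧ x < s}.Finite := by
  refine (S.2.1.union (finite_between x.1 0)).subset ?_
  rintro s ⟨hs, hx⟩
  by_cases h : 0 < s.1
  · exact Or.inl ⟨hs, h⟩
  · exact Or.inr ⟨le_of_lt hx, not_lt.1 h⟩

variable (k : Type*) [Field k]

theorem wedgeSign_insert_of_notMem {S : Config} {y : HalfInt} (hy : y ∉ S.1) (x : HalfInt) :
    wedgeSign k (S.insert y) x = if x < y then -wedgeSign k S x else wedgeSign k S x := by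
  split_ifs with h
  · have hs : {s | s ∈ (S.insert y).1 ∧ x < s} = insert y {s | s ∈ S.1 ∧ x < s} := by
      ext s
      simp only [Config.mem_insert, Set.mem_insert_iff, Set.mem_ofPred_eq]
      constructor
      · rintro ⟨rfl | h1, h2⟩
        · exact Or.inl rfl
        · exact Or.inr ⟨h1, h2⟩
      · rintro (rfl | h1)
        · exact ⟨Or.inl rfl, h⟩
        · exact ⟨Or.inr h1.1, h1.2⟩
    rw [wedgeSign, wedgeSign, hs, Set.ncard_insert_of_notMem (fun h1 => hy h1.1) (S.finite_gt x),
      pow_succ]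
    ring
  · have hs : {s | s ∈ (S.insert y).1 ∧ x < s} = {s | s ∈ S.1 ∧ x < s} := by
      ext s
      simp only [Config.mem_insert, Set.mem_ofPred_eq]
      constructor
      · rintro ⟨rfl | h1, h2⟩
        · exact absurd h2 h
        · exact ⟨h1, h2⟩
      · exact fun h1 => ⟨Or.inr h1.1, h1.2⟩
    rw [wedgeSign, wedgeSign, hs]

theorem Config.insert_erase {S : Config} {y : HalfInt} (hy : y ∈ S.1) :
    (S.erase y).insert y = S := (insert_eq_iff (notMem_erase S y)).2 ⟨hy, rfl⟩

theorem Config.erase_insert {S : Config} {y : HalfInt} (hy : y ∉ S.1) :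
    (S.insert y).erase y = S := ((insert_eq_iff hy).1 rfl).2

theorem Config.insert_comm (S : Config) (x y : HalfInt) :
    (S.insert x).insert y = (S.insert y).insert x :=
  Config.ext_mem fun s => by simp only [Config.mem_insert]; tauto

theorem Config.erase_comm (S : Config) (x y : HalfInt) :
    (S.erase x).erase y = (S.erase y).erase x :=
  Config.ext_mem fun s => by simp only [Config.mem_erase]; tauto

theorem Config.erase_insert_comm (S : Config) {x y : HalfInt} (h : x ≠ y) :
    (S.insert x).erase y = (S.erase y).insert x := by
  refine Config.ext_mem fun s => ?_
  simp only [Config.mem_erase, Config.mem_insert]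
  constructor
  · tauto
  · rintro (rfl | h1)
    · exact ⟨Or.inl rfl, h⟩
    · exact ⟨Or.inr h1.1, h1.2⟩

theorem wedgeSign_erase_of_mem {S : Config} {y : HalfInt} (hy : y ∈ S.1) (x : HalfInt) :
    wedgeSign k (S.erase y) x = if x < y then -wedgeSign k S x else wedgeSign k S x := by
  have h := wedgeSign_insert_of_notMem k (notMem_erase S y) x
  rw [Config.insert_erase hy] at h
  rw [h]
  split_ifs <;> simp

theorem wedgeSign_mul_self (S : Config) (x : HalfInt) :
    wedgeSign k S x * wedgeSign k S x = 1 := by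
  rw [wedgeSign, ← mul_pow]
  simp

variable {k} in
theorem psi_basisVec_of_mem {S : Config} {x : HalfInt} (h : x ∈ S.1) :
    psi k x (basisVec k S) = 0 := by
  simp [psi, basisVec, h]

variable {k} in
theorem psi_basisVec_of_notMem {S : Config} {x : HalfInt} (h : x ∉ S.1) :
    psi k x (basisVec k S) = wedgeSign k S x • basisVec k (S.insert x) := by
  simp [psi, basisVec, h]

variable {k} in
theorem psiStar_basisVec_of_mem {S : Config} {x : HalfInt} (h : x ∈ S.1) :
    psiStar k x (basisVec k S) = wedgeSign k S x • basisVec k (S.erase x) := by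
  simp [psiStar, basisVec, h]

variable {k} in
theorem psiStar_basisVec_of_notMem {S : Config} {x : HalfInt} (h : x ∉ S.1) :
    psiStar k x (basisVec k S) = 0 := by
  simp [psiStar, basisVec, h]

variable {k} in
theorem end_ext {f g : Module.End k (Wedge k)}
    (h : ∀ S, f (basisVec k S) = g (basisVec k S)) : f = g :=
  Finsupp.lhom_ext' fun S => LinearMap.ext_ring (h S)

theorem psi_mul_psi (x y : HalfInt) : psi k x * psi k y = -(psi k y * psi k x) := by
  refine end_ext fun S => ?_
  simp only [Module.End.mul_apply, LinearMap.neg_apply]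
  by_cases hx : x ∈ S.1
  · rw [psi_basisVec_of_mem hx, map_zero, neg_zero]
    by_cases hy : y ∈ S.1
    · rw [psi_basisVec_of_mem hy, map_zero]
    · rw [psi_basisVec_of_notMem hy, map_smul, psi_basisVec_of_mem (Or.inr hx), smul_zero]
  by_cases hy : y ∈ S.1
  · rw [psi_basisVec_of_mem hy, map_zero, psi_basisVec_of_notMem hx, map_smul,
      psi_basisVec_of_mem (Or.inr hy), smul_zero, neg_zero]
  rw [psi_basisVec_of_notMem hx, psi_basisVec_of_notMem hy, map_smul, map_smul]
  by_cases hxy : x = y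
  · subst hxy
    rw [psi_basisVec_of_mem (Or.inl rfl), smul_zero, neg_zero]
  rw [psi_basisVec_of_notMem (Config.mem_insert.not.2 (not_or.2 ⟨hxy, hx⟩)),
    psi_basisVec_of_notMem (Config.mem_insert.not.2 (not_or.2 ⟨Ne.symm hxy, hy⟩)),
    wedgeSign_insert_of_notMem k hy, wedgeSign_insert_of_notMem k hx, Config.insert_comm S x y,
    smul_smul, smul_smul, ← neg_smul]
  congr 1
  -- Only the smaller of `x` and `y` has the other among the elements above it, so exactly one of
  -- the two orders gains a sign.
  rcases lt_or_gt_of_ne hxy with h | h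
  · rw [if_pos h, if_neg h.asymm]
    ring
  · rw [if_pos h, if_neg h.asymm]
    ring

theorem psiStar_mul_psiStar (x y : HalfInt) :
    psiStar k x * psiStar k y = -(psiStar k y * psiStar k x) := by
  refine end_ext fun S => ?_
  simp only [Module.End.mul_apply, LinearMap.neg_apply]
  by_cases hx : x ∈ S.1
  swap
  · rw [psiStar_basisVec_of_notMem hx, map_zero, neg_zero]
    by_cases hy : y ∈ S.1
    · rw [psiStar_basisVec_of_mem hy, map_smul, psiStar_basisVec_of_notMem (mt And.left hx),
        smul_zero]
    · rw [psiStar_basisVec_of_notMem hy, map_zero]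
  by_cases hy : y ∈ S.1
  swap
  · rw [psiStar_basisVec_of_notMem hy, map_zero, psiStar_basisVec_of_mem hx, map_smul,
      psiStar_basisVec_of_notMem (mt And.left hy), smul_zero, neg_zero]
  rw [psiStar_basisVec_of_mem hx, psiStar_basisVec_of_mem hy, map_smul, map_smul]
  by_cases hxy : x = y
  · subst hxy
    rw [psiStar_basisVec_of_notMem (notMem_erase S x), smul_zero, neg_zero]
  rw [psiStar_basisVec_of_mem (Config.mem_erase.2 ⟨hx, hxy⟩),
    psiStar_basisVec_of_mem (Config.mem_erase.2 ⟨hy, Ne.symm hxy⟩),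
    wedgeSign_erase_of_mem k hy, wedgeSign_erase_of_mem k hx, Config.erase_comm S x y,
    smul_smul, smul_smul, ← neg_smul]
  congr 1
  rcases lt_or_gt_of_ne hxy with h | h
  · rw [if_pos h, if_neg h.asymm]
    ring
  · rw [if_pos h, if_neg h.asymm]
    ring

theorem psiStar_mul_psi_self (x : HalfInt) :
    psiStar k x * psi k x = 1 - psi k x * psiStar k x := by
  refine end_ext fun S => ?_
  simp only [Module.End.mul_apply, LinearMap.sub_apply, Module.End.one_apply]
  by_cases hx : x ∈ S.1
  · rw [psi_basisVec_of_mem hx, map_zero, psiStar_basisVec_of_mem hx, map_smul,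
      psi_basisVec_of_notMem (notMem_erase S x), wedgeSign_erase_of_mem k hx, if_neg (lt_irrefl x),
      Config.insert_erase hx, smul_smul, wedgeSign_mul_self, one_smul, sub_self]
  · rw [psiStar_basisVec_of_notMem hx, map_zero, psi_basisVec_of_notMem hx, map_smul,
      psiStar_basisVec_of_mem (Or.inl rfl), wedgeSign_insert, Config.erase_insert hx, smul_smul,
      wedgeSign_mul_self, one_smul, sub_zero]

theorem psiStar_mul_psi_of_ne {x y : HalfInt} (hxy : x ≠ y) :
    psiStar k x * psi k y = -(psi k y * psiStar k x) := by
  refine end_ext fun S => ?_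
  simp only [Module.End.mul_apply, LinearMap.neg_apply]
  by_cases hy : y ∈ S.1
  · rw [psi_basisVec_of_mem hy, map_zero]
    by_cases hx : x ∈ S.1
    · rw [psiStar_basisVec_of_mem hx, map_smul,
        psi_basisVec_of_mem (Config.mem_erase.2 ⟨hy, Ne.symm hxy⟩), smul_zero, neg_zero]
    · rw [psiStar_basisVec_of_notMem hx, map_zero, neg_zero]
  rw [psi_basisVec_of_notMem hy, map_smul]
  by_cases hx : x ∈ S.1
  swap
  · rw [psiStar_basisVec_of_notMem hx, map_zero, neg_zero,
      psiStar_basisVec_of_notMem (Config.mem_insert.not.2 (not_or.2 ⟨hxy, hx⟩)), smul_zero]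
  rw [psiStar_basisVec_of_mem hx, map_smul, psi_basisVec_of_notMem (mt And.left hy),
    psiStar_basisVec_of_mem (Or.inr hx), wedgeSign_insert_of_notMem k hy,
    wedgeSign_erase_of_mem k hx, Config.erase_insert_comm S (Ne.symm hxy), smul_smul, smul_smul,
    ← neg_smul]
  congr 1
  rcases lt_or_gt_of_ne hxy with h | h
  · rw [if_pos h, if_neg h.asymm]
    ring
  · rw [if_pos h, if_neg h.asymm]
    ring

variable {k} in
open Classical in
theorem psiStar_mul_psi (x y : HalfInt) :
    psiStar k x * psi k y = (if x = y then 1 else 0) - psi k y * psiStar k x := by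
  split_ifs with h
  · subst h
    exact psiStar_mul_psi_self k x
  · rw [psiStar_mul_psi_of_ne k h]
    exact LinearMap.ext fun w => (zero_sub _).symm

end Fermions

/-! ### Commutators of bosons with fermions -/

section Bosons

variable (k : Type*) [Field k]

theorem HalfInt.shift_shift (x : HalfInt) (m n : ℤ) : (x.shift m).shift n = x.shift (m + n) :=
  Subtype.ext (by simp only [HalfInt.shift]; push_cast; ring)

theorem HalfInt.shift_zero (x : HalfInt) : x.shift 0 = x :=
  Subtype.ext (by simp [HalfInt.shift])

theorem finite_support_alpha_apply {n : ℤ} (hn : n ≠ 0) (w : Wedge k) :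
    (Function.support fun x : HalfInt => psi k (x.shift n) (psiStar k x w)).Finite := by
  induction w using Finsupp.induction_linear with
  | zero => simp
  | add f g hf hg =>
    refine (hf.union hg).subset ?_
    simp only [map_add]
    exact Function.support_add _ _
  | single S a =>
    refine (finite_support_alpha k n hn S).subset fun x hx h0 => hx ?_
    have hS : (Finsupp.single S a : Wedge k) = a • basisVec k S := by simp [basisVec]
    simp only at h0 ⊢
    rw [hS, map_smul, map_smul, h0, smul_zero]

theorem alpha_apply {n : ℤ} (hn : n ≠ 0) (w : Wedge k) :
    alpha k n w = ∑ᶠ x : HalfInt, psi k (x.shift n) (psiStar k x w) := by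
  induction w using Finsupp.induction_linear with
  | zero => simp
  | add f g hf hg =>
    simp only [map_add]
    rw [hf, hg, finsum_add_distrib (finite_support_alpha_apply k hn f)
      (finite_support_alpha_apply k hn g)]
  | single S a =>
    have hS : (Finsupp.single S a : Wedge k) = a • basisVec k S := by simp [basisVec]
    simp only [hS, map_smul]
    rw [← smul_finsum' a (finite_support_alpha k n hn S)]
    congr 1
    simp [alpha, basisVec]

theorem finsum_ite_apply_eq {ι M : Type*} [AddCommMonoid M] (a : ι) (m : M) [DecidableEq ι] :
    ∑ᶠ x, (if x = a then m else 0) = m := by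
  rw [finsum_eq_single _ a fun x hx => if_neg hx, if_pos rfl]

/-- Moving `ψ_y` to the left past `ψ_{x-n} ψ*_x` costs two signs, which cancel; only `x = y` leaves
a remainder. -/
theorem alpha_mul_psi {n : ℤ} (hn : n ≠ 0) (y : HalfInt) :
    alpha k n * psi k y = psi k y * alpha k n + psi k (y.shift n) := by
  classical
  refine LinearMap.ext fun w => ?_
  have hw (x : HalfInt) : psi k (x.shift n) (psiStar k x (psi k y w)) =
      psi k y (psi k (x.shift n) (psiStar k x w)) +
        if x = y then psi k (y.shift n) w else 0 := by
    have h1 := LinearMap.congr_fun (psi_mul_psi k (x.shift n) y) (psiStar k x w)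
    have h2 := LinearMap.congr_fun (psiStar_mul_psi (k := k) x y) w
    simp only [Module.End.mul_apply, LinearMap.neg_apply, LinearMap.sub_apply] at h1 h2
    rw [h2, map_sub, h1, sub_neg_eq_add, add_comm]
    split_ifs with h
    · rw [h, Module.End.one_apply]
    · rw [LinearMap.zero_apply, map_zero]
  rw [LinearMap.add_apply, Module.End.mul_apply, Module.End.mul_apply, alpha_apply k hn,
    alpha_apply k hn, finsum_congr hw, finsum_add_distrib, finsum_ite_apply_eq,
    map_finsum _ (finite_support_alpha_apply k hn w)]
  · refine (finite_support_alpha_apply k hn w).subset fun x hx h0 => hx ?_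
    simp only at h0 ⊢
    rw [h0, map_zero]
  · exact (Set.finite_singleton y).subset fun x hx => by_contra fun h => hx (if_neg h)

theorem HalfInt.eq_shift_neg_iff {x y : HalfInt} {n : ℤ} : x = y.shift (-n) ↔ y = x.shift n := by
  constructor
  · rintro rfl
    rw [HalfInt.shift_shift, neg_add_cancel, HalfInt.shift_zero]
  · rintro rfl
    rw [HalfInt.shift_shift, add_neg_cancel, HalfInt.shift_zero]

/-- Here the remainder comes from `ψ_{x-n}` meeting `ψ*_y`, hence from `x = y + n`, after one sign
change. -/
theorem alpha_mul_psiStar {n : ℤ} (hn : n ≠ 0) (y : HalfInt) :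
    alpha k n * psiStar k y = psiStar k y * alpha k n - psiStar k (y.shift (-n)) := by
  classical
  refine LinearMap.ext fun w => ?_
  have hw (x : HalfInt) : psi k (x.shift n) (psiStar k x (psiStar k y w)) =
      psiStar k y (psi k (x.shift n) (psiStar k x w)) +
        if x = y.shift (-n) then -psiStar k (y.shift (-n)) w else 0 := by
    have h1 := LinearMap.congr_fun (psiStar_mul_psiStar k x y) w
    have h2 := LinearMap.congr_fun (psiStar_mul_psi (k := k) y (x.shift n)) (psiStar k x w)
    simp only [Module.End.mul_apply, LinearMap.neg_apply, LinearMap.sub_apply] at h1 h2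
    rw [h1, h2, map_neg]
    by_cases h : x = y.shift (-n)
    · rw [if_pos h, if_pos (HalfInt.eq_shift_neg_iff.1 h), ← h, Module.End.one_apply]
      abel
    · rw [if_neg h, if_neg (mt HalfInt.eq_shift_neg_iff.2 h), LinearMap.zero_apply]
      abel
  rw [LinearMap.sub_apply, Module.End.mul_apply, Module.End.mul_apply, alpha_apply k hn,
    alpha_apply k hn, finsum_congr hw, finsum_add_distrib, finsum_ite_apply_eq,
    map_finsum _ (finite_support_alpha_apply k hn w), sub_eq_add_neg]
  · refine (finite_support_alpha_apply k hn w).subset fun x hx h0 => hx ?_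
    simp only at h0 ⊢
    rw [h0, map_zero]
  · exact (Set.finite_singleton (y.shift (-n))).subset
      fun x hx => by_contra fun h => hx (if_neg h)

end Bosons

/-! ### Conjugated fermions -/

section Vertex

variable {k : Type*} [Field k]

/-- The linear map from Laurent polynomials that sends `zⁿ` to `bₙ`. -/
def laurentLift {M : Type*} [AddCommGroup M] [Module k M] (b : ℤ → M) :
    LaurentPolynomial k →ₗ[k] M :=
  Finsupp.linearCombination k b ∘ₗ (AddMonoidAlgebra.coeffLinearEquiv k).toLinearMap

theorem laurentLift_T {M : Type*} [AddCommGroup M] [Module k M] (b : ℤ → M) (n : ℤ) :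
    laurentLift b (LaurentPolynomial.T n : LaurentPolynomial k) = b n := by
  refine (Finsupp.linearCombination_single k 1 n).trans ?_
  exact one_smul k _

/-- `zⁿ ↦ ψ_{i - n}`. -/
def psiLift (i : HalfInt) : LaurentPolynomial k →ₗ[k] Module.End k (Wedge k) :=
  laurentLift fun n => psi k (i.shift n)

/-- `zⁿ ↦ ψ*_{j + n}`. -/
def psiStarLift (j : HalfInt) : LaurentPolynomial k →ₗ[k] Module.End k (Wedge k) :=
  laurentLift fun n => psiStar k (j.shift (-n))

theorem alpha_mul_psiLift {n : ℤ} (hn : n ≠ 0) (i : HalfInt) (p : LaurentPolynomial k) :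
    alpha k n * psiLift i p =
      psiLift i p * alpha k n + psiLift i (LaurentPolynomial.T n * p) := by
  induction p using LaurentPolynomial.induction_on' with
  | add p q hp hq =>
    rw [mul_add, map_add, map_add, mul_add, add_mul, hp, hq]
    abel
  | C_mul_T m a =>
    rw [← LaurentPolynomial.smul_eq_C_mul, mul_smul_comm, map_smul, map_smul, mul_smul_comm,
      smul_mul_assoc, ← smul_add, ← LaurentPolynomial.T_add, psiLift, laurentLift_T,
      laurentLift_T, alpha_mul_psi k hn, HalfInt.shift_shift, add_comm m n]

theorem alpha_mul_psiStarLift {n : ℤ} (hn : n ≠ 0) (j : HalfInt) (p : LaurentPolynomial k) :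
    alpha k n * psiStarLift j p =
      psiStarLift j p * alpha k n + psiStarLift j (-LaurentPolynomial.T n * p) := by
  induction p using LaurentPolynomial.induction_on' with
  | add p q hp hq =>
    rw [mul_add, map_add, map_add, mul_add, add_mul, hp, hq]
    abel
  | C_mul_T m a =>
    rw [← LaurentPolynomial.smul_eq_C_mul, mul_smul_comm, map_smul, map_smul, mul_smul_comm,
      smul_mul_assoc, ← smul_add, neg_mul, ← LaurentPolynomial.T_add, map_neg, psiStarLift,
      laurentLift_T, laurentLift_T, alpha_mul_psiStar k hn, HalfInt.shift_shift, ← neg_add,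
      add_comm m n]
    exact congrArg _ (LinearMap.ext fun w => sub_eq_add_neg _ _)

/-- `φ` turns the commutator with each `αₙ`, `n ≠ 0`, into the multiplication by `lₙ`. -/
def IntertwinesCommutators {P A : Type*} [CommRing P] [Algebra k P] [Ring A] [Algebra k A]
    (φ : P →ₗ[k] A) (α : ℤ → A) (l : ℤ → P) : Prop :=
  ∀ n ≠ 0, ∀ p, α n * φ p = φ p * α n + φ (l n * p)

theorem linearExp_conj [CharZero k] {P A : Type*} [CommRing P] [Algebra k P] [Ring A]
    [Algebra k A] (φ : P →ₗ[k] A) (α : ℤ → A) (l : ℤ → P)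
    (h : IntertwinesCommutators φ α l) (U V : (TSeries A)ˣ)
    (hU : (U : TSeries A) = linearExp k (Sum.elim (fun n : ℕ+ => α n) fun _ => 0))
    (hV : (V : TSeries A) = linearExp k (Sum.elim (fun _ => 0) fun n : ℕ+ => α (-n))) :
    ((U * V⁻¹ : (TSeries A)ˣ) : TSeries A) * MvPowerSeries.C (φ 1) *
        (((U * V⁻¹)⁻¹ : (TSeries A)ˣ) : TSeries A) =
      coeffMap φ (linearExp k (Sum.elim (fun n : ℕ+ => l n) fun n : ℕ+ => -l (-n))) := by
  set a : Var → P := Sum.elim (fun n : ℕ+ => l n) 0 with ha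
  set b : Var → P := Sum.elim 0 (fun n : ℕ+ => l (-n)) with hb
  have hab : (Sum.elim (fun n : ℕ+ => l n) fun n : ℕ+ => -l (-n)) = a + -b := by
    funext v
    rcases v with n | n <;> simp [ha, hb]
  have hplus (f : TSeries P) : U * coeffMap φ f = coeffMap φ (linearExp k a * f) * U := by
    rw [hU]
    refine linearExp_mul_coeffMap φ _ a ?_ f
    rintro (n | n) p
    · exact h n (by exact_mod_cast n.ne_zero) p
    · simp [ha]
  have hminus (f : TSeries P) : V * coeffMap φ f = coeffMap φ (linearExp k b * f) * V := by
    rw [hV]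
    refine linearExp_mul_coeffMap φ _ b ?_ f
    rintro (n | n) p
    · simp [hb]
    · exact h (-n) (by simp) p
  -- Chosen so that `linearExp k b` cancels: conjugation by `V⁻¹` multiplies by `linearExp k (-b)`.
  have hminus' := hminus (linearExp k (-b))
  rw [mul_comm (linearExp k b), linearExp_neg_mul] at hminus'
  rw [Units.mul_inv_eq_iff_eq_mul, hab, linearExp_add, ← coeffMap_C, map_one, Units.val_mul,
    mul_assoc]
  have h1 : ((V⁻¹ : (TSeries A)ˣ) : TSeries A) * coeffMap φ 1 =
      coeffMap φ (linearExp k (-b)) * ((V⁻¹ : (TSeries A)ˣ) : TSeries A) := by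
    rw [Units.inv_mul_eq_iff_eq_mul, ← mul_assoc, Units.eq_mul_inv_iff_mul_eq]
    exact hminus'.symm
  rw [h1, ← mul_assoc, ← mul_assoc, hplus]

theorem J_eq_linearExp : J k = linearExp k (Sum.elim
    (fun n : ℕ+ => LaurentPolynomial.T (n : ℤ))
    (fun n : ℕ+ => -LaurentPolynomial.T (-(n : ℤ)))) := rfl

theorem GammaPlus_eq_linearExp :
    GammaPlus k = linearExp k (Sum.elim (fun n : ℕ+ => alpha k n) fun _ => 0) := rfl

theorem GammaMinus_eq_linearExp :
    GammaMinus k = linearExp k (Sum.elim (fun _ => 0) fun n : ℕ+ => alpha k (-n)) := rfl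

theorem intertwinesCommutators_psiLift (i : HalfInt) :
    IntertwinesCommutators (k := k) (psiLift i) (alpha k) LaurentPolynomial.T := by
  intro n hn p
  have h := alpha_mul_psiLift hn i p
  exact h

theorem intertwinesCommutators_psiStarLift (j : HalfInt) :
    IntertwinesCommutators (k := k) (psiStarLift j) (alpha k)
      fun n => -LaurentPolynomial.T n := by
  intro n hn p
  have h := alpha_mul_psiStarLift hn j p
  exact h

theorem Psi_eq_coeffMap [CharZero k] (i : HalfInt) : Psi k i = coeffMap (psiLift i) (J k) := by
  have h := linearExp_conj _ _ _ (intertwinesCommutators_psiLift (k := k) i)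
    (isUnit_GammaPlus k).unit
    (isUnit_GammaMinus k).unit ((isUnit_GammaPlus k).unit_spec.trans GammaPlus_eq_linearExp)
    ((isUnit_GammaMinus k).unit_spec.trans GammaMinus_eq_linearExp)
  have h1 : psiLift i (1 : LaurentPolynomial k) = psi k i := by
    rw [← LaurentPolynomial.T_zero, psiLift, laurentLift_T, HalfInt.shift_zero]
  rw [h1] at h
  exact h

theorem PsiStar_eq_coeffMap [CharZero k] (j : HalfInt) :
    PsiStar k j = coeffMap (psiStarLift j) (MvPowerSeries.rescale (fun _ => -1) (J k)) := by
  have h := linearExp_conj _ _ _ (intertwinesCommutators_psiStarLift (k := k) j)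
    (isUnit_GammaPlus k).unit
    (isUnit_GammaMinus k).unit ((isUnit_GammaPlus k).unit_spec.trans GammaPlus_eq_linearExp)
    ((isUnit_GammaMinus k).unit_spec.trans GammaMinus_eq_linearExp)
  have h1 : psiStarLift j (1 : LaurentPolynomial k) = psiStar k j := by
    rw [← LaurentPolynomial.T_zero, psiStarLift, laurentLift_T, neg_zero, HalfInt.shift_zero]
  rw [h1] at h
  rw [J_eq_linearExp, rescale_neg_one_linearExp]
  refine Eq.trans h ?_
  congr 2
  funext v
  rcases v with n | n <;> simp

/-- Rescaling multiplies the coefficient at `d` by `(-1) ^ d.degree`, which commutes with extracting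
`zⁿ`. -/
theorem coeff_negTimes_besselJ (d : Var →₀ ℕ) (n : ℤ) :
    MvPowerSeries.coeff d (negTimes (besselJ k n)) =
      (MvPowerSeries.coeff d (MvPowerSeries.rescale (fun _ => -1) (J k))).coeff n := by
  rw [negTimes, coeff_rescale_neg_one, coeff_rescale_neg_one]
  have : MvPowerSeries.coeff d (besselJ k n) = (MvPowerSeries.coeff d (J k)).coeff n := rfl
  rw [this]
  rcases Nat.even_or_odd d.degree with h | h
  · rw [h.neg_one_pow, h.neg_one_pow, one_mul, one_mul]
  · rw [h.neg_one_pow, h.neg_one_pow, neg_one_mul, neg_one_mul]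
    rfl

/-! ### Vacuum expectations -/

theorem innerProd_vac (f : Wedge k) : innerProd f (vac k) = f Config.vacuum := by
  classical
  simp only [innerProd, vac, basisVec, Finsupp.sum, Finsupp.single_apply, mul_ite, mul_one,
    mul_zero]
  rw [Finset.sum_ite_eq]
  split_ifs with h
  · rfl
  · exact (Finsupp.notMem_support_iff.1 h).symm

open Classical in
theorem psi_psiStar_vac (x y : HalfInt) :
    psi k x (psiStar k y (vac k)) Config.vacuum = if x = y ∧ x.1 < 0 then 1 else 0 := by
  by_cases hy : y ∈ Config.vacuum.1
  swap
  · rw [vac, psiStar_basisVec_of_notMem hy, map_zero, if_neg]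
    · rfl
    · rintro ⟨rfl, h⟩
      exact hy h
  rw [vac, psiStar_basisVec_of_mem hy, map_smul]
  by_cases hxy : x = y
  · subst hxy
    rw [psi_basisVec_of_notMem (notMem_erase _ x), wedgeSign_erase_of_mem k hy,
      if_neg (lt_irrefl x), Config.insert_erase hy, smul_smul, wedgeSign_mul_self, if_pos ⟨rfl, hy⟩]
    simp [basisVec]
  · rw [if_neg fun h => hxy h.1]
    by_cases hx : x ∈ (Config.vacuum.erase y).1
    · rw [psi_basisVec_of_mem hx, smul_zero]
      rfl
    · rw [psi_basisVec_of_notMem hx, basisVec, Finsupp.smul_apply, Finsupp.smul_apply,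
        Finsupp.single_apply, if_neg, smul_zero, smul_zero]
      intro h
      have := h ▸ hy
      rcases Config.mem_insert.1 this with h1 | h1
      · exact hxy h1.symm
      · exact notMem_erase _ y h1

/-- The floor is exact on a sum of half-integers. This translates the exponent `n` into the vacuum
position `i - n = -x`. -/
theorem HalfInt.floor_add_eq_iff (i x : HalfInt) (n : ℤ) :
    n = ⌊i.1 + x.1⌋ ↔ x.1 = -(i.shift n).1 := by
  obtain ⟨i, a, rfl⟩ := i
  obtain ⟨x, b, rfl⟩ := x
  have h : ⌊((a : ℚ) + 1 / 2) + (b + 1 / 2)⌋ = a + b + 1 := by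
    rw [Int.floor_eq_iff]
    push_cast
    constructor <;> linarith
  simp only [HalfInt.shift, h]
  constructor
  · rintro rfl
    push_cast
    ring
  · intro h
    have : (n : ℚ) = (a + b + 1 : ℤ) := by push_cast; linarith
    exact_mod_cast this

theorem HalfInt.floor_neg_sub_eq_iff (j x : HalfInt) (n : ℤ) :
    n = ⌊-j.1 - x.1⌋ ↔ x.1 = -(j.shift (-n)).1 := by
  obtain ⟨j, a, rfl⟩ := j
  obtain ⟨x, b, rfl⟩ := x
  have h : ⌊-((a : ℚ) + 1 / 2) - (b + 1 / 2)⌋ = -a - b - 1 := by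
    rw [Int.floor_eq_iff]
    push_cast
    constructor <;> linarith
  simp only [HalfInt.shift, h]
  constructor
  · rintro rfl
    push_cast
    ring
  · intro h
    have : (n : ℚ) = (-a - b - 1 : ℤ) := by push_cast at h ⊢; linarith
    exact_mod_cast this

theorem finite_support_coeff_floor (i : HalfInt) (p : LaurentPolynomial k) :
    {x : {x : HalfInt // 0 < x.1} | p.coeff ⌊i.1 + x.1.1⌋ ≠ 0}.Finite := by
  refine Set.Finite.preimage (f := fun x : {x : HalfInt // 0 < x.1} => ⌊i.1 + x.1.1⌋) ?_
    p.coeff.hasFiniteSupport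
  intro x _ y _ hxy
  have hx := (HalfInt.floor_add_eq_iff i x.1 _).1 rfl
  have hy := (HalfInt.floor_add_eq_iff i y.1 _).1 rfl
  simp only at hxy
  rw [hxy] at hx
  exact Subtype.ext (Subtype.ext (hx.trans hy.symm))

theorem finite_support_coeff_floor_mul (i : HalfInt) (p : LaurentPolynomial k)
    (g : {x : HalfInt // 0 < x.1} → k) :
    (Function.support fun x : {x : HalfInt // 0 < x.1} =>
      p.coeff ⌊i.1 + x.1.1⌋ * g x).Finite :=
  (finite_support_coeff_floor i p).subset fun _ hx => left_ne_zero_of_mul hx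

/-- Both sides are bilinear in `p` and `q`, which reduces the claim to monomials `zⁿ`, `zᵐ`. -/
theorem psiLift_psiStarLift_vac (i j : HalfInt) (p q : LaurentPolynomial k) :
    psiLift i p (psiStarLift j q (vac k)) Config.vacuum =
      ∑ᶠ x : {x : HalfInt // 0 < x.1}, p.coeff ⌊i.1 + x.1.1⌋ * q.coeff ⌊-j.1 - x.1.1⌋ := by
  classical
  induction p using LaurentPolynomial.induction_on' with
  | add p p' hp hp' =>
    rw [map_add, LinearMap.add_apply, Finsupp.add_apply, hp, hp',
      ← finsum_add_distrib (finite_support_coeff_floor_mul i p _)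
        (finite_support_coeff_floor_mul i p' _)]
    simp only [AddMonoidAlgebra.coeff_add, Finsupp.add_apply, add_mul]
  | C_mul_T n a =>
    induction q using LaurentPolynomial.induction_on' with
    | add q q' hq hq' =>
      rw [map_add, LinearMap.add_apply, map_add, Finsupp.add_apply, hq, hq',
        ← finsum_add_distrib (finite_support_coeff_floor_mul i _ _)
          (finite_support_coeff_floor_mul i _ _)]
      simp only [AddMonoidAlgebra.coeff_add, Finsupp.add_apply, mul_add]
    | C_mul_T m b =>
      simp only [← LaurentPolynomial.smul_eq_C_mul, map_smul, LinearMap.smul_apply,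
        Finsupp.smul_apply, AddMonoidAlgebra.coeff_smul, LaurentPolynomial.T_apply, psiLift,
        psiStarLift, laurentLift_T, psi_psiStar_vac, HalfInt.floor_add_eq_iff,
        HalfInt.floor_neg_sub_eq_iff, smul_eq_mul]
      by_cases h : i.shift n = j.shift (-m) ∧ (i.shift n).1 < 0
      · have hmem : ∃ r : ℤ, -(i.shift n).1 = r + 1 / 2 := by
          obtain ⟨r, hr⟩ := (i.shift n).2
          exact ⟨-r - 1, by rw [hr]; push_cast; ring⟩
        -- The only contributing index is `x = -(i - n)`, positive because the position `i - n` is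
        -- filled in the vacuum.
        rw [if_pos h, finsum_eq_single _ ⟨⟨-(i.shift n).1, hmem⟩, by simpa using h.2⟩]
        · rw [if_pos rfl, if_pos (congrArg (fun y : HalfInt => -y.1) h.1)]
          ring
        · intro x hx
          rw [if_neg fun h1 => hx (Subtype.ext (Subtype.ext h1)), mul_zero, zero_mul]
      · rw [if_neg h, mul_zero, mul_zero, finsum_eq_zero_of_forall_eq_zero]
        intro x
        by_cases h1 : x.1.1 = -(i.shift n).1
        · rw [if_neg (c := x.1.1 = -(j.shift (-m)).1), mul_zero, mul_zero]
          intro h2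
          refine h ⟨Subtype.ext (by linarith), ?_⟩
          linarith [x.2]
        · rw [if_neg h1, mul_zero, zero_mul]

theorem K_formalHasSum [CharZero k] (i j : HalfInt) :
    FormalHasSum
      (fun x : {x : HalfInt // 0 < x.1} =>
        besselJ k ⌊i.1 + x.1.1⌋ *
          negTimes (besselJ k ⌊-j.1 - x.1.1⌋))
      (K k i j) := by
  classical
  intro d
  have hcoeff (x : {x : HalfInt // 0 < x.1}) :
      MvPowerSeries.coeff d (besselJ k ⌊i.1 + x.1.1⌋ * negTimes (besselJ k ⌊-j.1 - x.1.1⌋)) =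
        ∑ p ∈ Finset.HasAntidiagonal.antidiagonal d,
          (MvPowerSeries.coeff p.1 (J k)).coeff ⌊i.1 + x.1.1⌋ *
            (MvPowerSeries.coeff p.2
              (MvPowerSeries.rescale (fun _ => -1) (J k))).coeff ⌊-j.1 - x.1.1⌋ := by
    simp only [MvPowerSeries.coeff_mul, coeff_negTimes_besselJ]
    rfl
  have hfin (p : (Var →₀ ℕ) × (Var →₀ ℕ)) :=
    finite_support_coeff_floor_mul i (MvPowerSeries.coeff p.1 (J k)) fun x =>
      (MvPowerSeries.coeff p.2 (MvPowerSeries.rescale (fun _ => -1) (J k))).coeff ⌊-j.1 - x.1.1⌋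
  simp only [hcoeff]
  constructor
  · refine ((Finset.HasAntidiagonal.antidiagonal d).finite_toSet.biUnion
      fun p _ => hfin p).subset fun x hx => ?_
    obtain ⟨p, hp, h⟩ := Finset.exists_ne_zero_of_sum_ne_zero hx
    exact Set.mem_biUnion (Finset.mem_coe.2 hp) h
  -- The sum over `x` may be exchanged with the finite sum over splittings of `d`, since each
  -- summand has finite support in `x`.
  · rw [finsum_sum_comm _ _ fun p _ => hfin p]
    change innerProd (MvPowerSeries.coeff d (Psi k i * PsiStar k j) (vac k)) (vac k) = _
    rw [innerProd_vac, Psi_eq_coeffMap, PsiStar_eq_coeffMap, MvPowerSeries.coeff_mul,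
      LinearMap.sum_apply, Finsupp.finsetSum_apply]
    exact Finset.sum_congr rfl fun p _ => psiLift_psiStarLift_vac i j _ _

end Vertex

end SchurMeasure

end

/-- `K(i, j) = ∑ J_{i+x}(t, t') J_{-j-x}(-t, -t')`, the sum being over the positive
half-integers `x`. The numbers `i + x` and `-j - x` are integers, so the floors below only change
their type from `ℚ` to `ℤ`. -/
theorem corollary1 (k : Type*) [Field k] [CharZero k] (i j : SchurMeasure.HalfInt) :
    SchurMeasure.FormalHasSum
      (fun x : {x : SchurMeasure.HalfInt // 0 < x.1} =>
        SchurMeasure.besselJ k ⌊i.1 + x.1.1⌋ *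
          SchurMeasure.negTimes (SchurMeasure.besselJ k ⌊-j.1 - x.1.1⌋))
      (SchurMeasure.K k i j) :=
  SchurMeasure.K_formalHasSum i j
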